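/- **Theorem.** There is an absolute constant $\kappa>0$ such that the following holds for all integers $n\ge 0$, $d\ge 0$, all reals $0<\epsilon<\frac1{32}$ and $0<\delta\le\frac15$, and every non-empty, non-trivial class $C$ of concepts $c:\{0,1\}^n\to\{0,1\}$ of Vapnik–Chervonenkis dimension $d$. Every quantum $(\epsilon,\delta)$-PAC learning algorithm for $C$ makes $$T\;\ge\;\kappa\left(\frac1\epsilon\log\frac1\delta+d+\frac{\sqrt d}{\epsilon}\right)$$ calls to the quantum example oracle, that is, at least $\Omega\bigl(\frac1\epsilon\log\frac1\delta+d+\frac{\sqrt d}\epsilon\bigr)$ calls. Here $C$ is *trivial* if it consists of a single concept, or of exactly two concepts $c_0,c_1$ with $c_0(x)\ne c_1(x)$ for every $x\in\{0,1\}^n$. The VC dimension of $C$ is the largest size of a set $W\subseteq\{0,1\}^n$ such that every $W'\subseteq W$ equals $\{x\in W: c(x)=1\}$ for some $c\in C$. For a concept $c$ and a probability distribution $\mathcal D$ on $\{0,1\}^n$, the quantum example oracle $QEX(c,\mathcal D)$ acts on $n+1$ qubits, may be invoked only when these are in the basis state $|0^n,0\rangle$, and maps it to $\sum_{x}\sqrt{\mathcal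 D(x)}\,|x,c(x)\rangle$. A quantum algorithm with $T$ oracle calls acts on these $n+1$ qubits and any finite number of work qubits: starting from the all-zero state it applies $U_0,QEX(c,\mathcal D),U_1,\dots,QEX(c,\mathcal D),U_T$, where the unitaries $U_i$ do not depend on $c$ or $\mathcal D$; it then measures in the computational basis, and the outcome determines, by a fixed rule, a hypothesis $h:\{0,1\}^n\to\{0,1\}$. It is a *quantum $(\epsilon,\delta)$-PAC learning algorithm for $C$* if for every $c\in C$ and every probability distribution $\mathcal D$ on $\{0,1\}^n$, all its oracle calls are made with the oracle's qubits in the state $|0^n,0\rangle$, and with probability at least $1-\delta$ it outputs an $h$ with $\Pr_{x\sim\mathcal D}[h(x)\ne c(x)]\le\epsilon$. -/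

import Mathlib

namespace QPAC

/-- Inputs, the elements of `{0,1}^n`. -/
abbrev Input (n : ℕ) : Type := Fin n → Bool

/-- Concepts over `{0,1}^n`: Boolean functions on `{0,1}^n`. -/
abbrev Concept (n : ℕ) : Type := Input n → Bool

/-- The subset `{x : c x = 1}` of `{0,1}^n` that corresponds to the concept `c`. -/
def Concept.toFinset {n : ℕ} (c : Concept n) : Finset (Input n) :=
  Finset.univ.filter fun x => c x = true

/-- The Vapnik-Chervonenkis dimension of a concept class: the largest size of a set of inputs
that is shattered by the class (concepts being viewed as subsets of `{0,1}^n`). -/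
def vcDimension {n : ℕ} (C : Finset (Concept n)) : ℕ :=
  (C.image Concept.toFinset).vcDim

/-- A class is trivial if it has exactly one concept, or exactly two concepts such that every
input belongs to exactly one of them. -/
def IsTrivialClass {n : ℕ} (C : Finset (Concept n)) : Prop :=
  (∃ c, C = {c}) ∨ ∃ c₀ c₁ : Concept n, C = {c₀, c₁} ∧ ∀ x, c₀ x ≠ c₁ x

/-- The error `Pr_{x ∼ D}[h x ≠ c x]` of the hypothesis `h` on the target `c`. -/
noncomputable def error {n : ℕ} (D : Input n → ℝ) (h c : Concept n) : ℝ :=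
  ∑ x with h x ≠ c x, D x

/-- Computational basis states `|x, b⟩` of the `n + 1` qubits on which the example oracle acts. -/
abbrev ExampleReg (n : ℕ) : Type := Input n × Bool

/-- Computational basis states of the whole quantum register: the `n + 1` qubits of the example
oracle together with `m` work qubits. -/
abbrev Basis (n m : ℕ) : Type := ExampleReg n × (Fin m → Bool)

/-- The basis state `|0^n, 0⟩`. -/
def zeroExample (n : ℕ) : ExampleReg n := (fun _ => false, false)

/-- The superposition of labelled examples `∑ x, √(D x) |x, c x⟩`. -/
noncomputable def exampleState {n : ℕ} (c : Concept n) (D : Input n → ℝ) : ExampleReg n → ℂ :=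
  fun e => if e.2 = c e.1 then (Real.sqrt (D e.1) : ℂ) else 0

/-- The oracle `QEX(c, D)` may be invoked only with its `n + 1` qubits in the state `|0^n, 0⟩`,
i.e. on a state of the form `|0^n, 0⟩ ⊗ φ`. -/
def LegalCall {n m : ℕ} (ψ : Basis n m → ℂ) : Prop :=
  ∀ e w, e ≠ zeroExample n → ψ (e, w) = 0

/-- The action `|0^n, 0⟩ ⊗ φ ↦ (∑ x, √(D x) |x, c x⟩) ⊗ φ` of the oracle `QEX(c, D)`.
It is meaningful on the states `ψ` with `LegalCall ψ`, and only used on these. -/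
noncomputable def QEX {n m : ℕ} (c : Concept n) (D : Input n → ℝ) (ψ : Basis n m → ℂ) :
    Basis n m → ℂ :=
  fun b => exampleState c D b.1 * ψ (zeroExample n, b.2)

/-- A quantum algorithm with access to a quantum example oracle: it applies
`U 0, QEX, U 1, QEX, …, QEX, U T` (with `T = calls`) to the all-zero state, where the unitary
transformations `U i` are fixed, measures in the computational basis, and reads the measured
string as (a representation of) a hypothesis. The number of work qubits is arbitrary, so fresh
qubits can be swapped into the position of the oracle before each call.
The values `U i` for `i > calls` play no role. -/
structure Algorithm (n : ℕ) where
  /-- the number of work qubits -/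
  work : ℕ
  /-- the number of `QEX` gates, i.e. the quantum sample complexity -/
  calls : ℕ
  /-- the unitary transformations between the calls -/
  U : ℕ → Matrix.unitaryGroup (Basis n work) ℂ
  /-- the hypothesis represented by a measurement outcome -/
  output : Basis n work → Concept n

open scoped Matrix in
/-- The state after `t` oracle calls, each of them followed by the next unitary. -/
noncomputable def Algorithm.state {n : ℕ} (A : Algorithm n) (c : Concept n) (D : Input n → ℝ) :
    ℕ → Basis n A.work → ℂ
  | 0 => (A.U 0).1 *ᵥ Pi.single (zeroExample n, fun _ => false) 1
  | t + 1 => (A.U (t + 1)).1 *ᵥ QEX c D (A.state c D t)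

open scoped Classical in
/-- The probability that the measurement of the final state yields a hypothesis whose error is at
most `ε`. -/
noncomputable def Algorithm.successProb {n : ℕ} (A : Algorithm n) (c : Concept n)
    (D : Input n → ℝ) (ε : ℝ) : ℝ :=
  ∑ b with error D (A.output b) c ≤ ε, ‖A.state c D A.calls b‖ ^ 2

/-- `A` is a quantum `(ε, δ)`-PAC learning algorithm for `C`: for every target concept in `C` and
every probability distribution on `{0,1}^n`, it invokes the oracle only on `|0^n, 0⟩` and outputs
with probability at least `1 - δ` a hypothesis of error at most `ε`. -/
def Algorithm.PACLearns {n : ℕ} (A : Algorithm n) (C : Finset (Concept n)) (ε δ : ℝ) : Prop :=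
  ∀ c ∈ C, ∀ D ∈ stdSimplex ℝ (Input n),
    (∀ t < A.calls, LegalCall (A.state c D t)) ∧ 1 - δ ≤ A.successProb c D ε

end QPAC

/-! Legal oracle calls amount to receiving copies of the example state, so each call multiplies the
overlap of the runs for targets `c` and `c'` by exactly `1 - error D c c'`, while unitaries preserve
it (`Algorithm.state_star_dotProduct`). If `c` and `c'` differ at `x`, a large final overlap forces
a wrong prediction at `x` with noticeable probability for one of them
(`Algorithm.overlap_le_errorProbAt`).

Two concepts that agree at one point and differ at another of mass `2 * ε` yield the term `1 / ε *
log (1 / δ)`. On a shattered set carrying mass `32 * ε`, neighbouring labellings have error only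
about `32 * ε / d`, and averaging over all labellings (`Algorithm.overlap_le_of_shatters`) gives
order `d / ε` calls. This dominates both `d` and `√d / ε`. -/

namespace QPAC

open scoped Matrix

variable {n m : ℕ}

/-! ### Overlaps and distinguishability -/

theorem unitary_star_dotProduct {B : Type*} [Fintype B] [DecidableEq B]
    (U : Matrix.unitaryGroup B ℂ) (v w : B → ℂ) :
    star (U.1 *ᵥ v) ⬝ᵥ (U.1 *ᵥ w) = star v ⬝ᵥ w := by
  have hU : U.1ᴴ * U.1 = 1 := Matrix.mem_unitaryGroup_iff'.1 U.2
  rw [Matrix.star_mulVec, Matrix.dotProduct_mulVec, Matrix.vecMul_vecMul, hU, Matrix.vecMul_one]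

theorem star_dotProduct_eq_of_legalCall {ψ φ : Basis n m → ℂ} (hψ : LegalCall ψ) :
    star ψ ⬝ᵥ φ = ∑ w, star (ψ (zeroExample n, w)) * φ (zeroExample n, w) := by
  rw [dotProduct, Fintype.sum_prod_type, Finset.sum_eq_single (zeroExample n)]
  · rfl
  · intro e _ he
    exact Finset.sum_eq_zero fun w _ => by simp [hψ e w he]
  · simp

/-- One legal state suffices: its support confines the overlap to the components on `zeroExample n`,
the only ones that `QEX` reads. -/
theorem QEX_star_dotProduct (c c' : Concept n) (D : Input n → ℝ) {ψ φ : Basis n m → ℂ}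
    (hψ : LegalCall ψ) :
    star (QEX c D ψ) ⬝ᵥ QEX c' D φ =
      (star (exampleState c D) ⬝ᵥ exampleState c' D) * (star ψ ⬝ᵥ φ) := by
  rw [star_dotProduct_eq_of_legalCall hψ, dotProduct, dotProduct, Fintype.sum_prod_type,
    Finset.sum_mul_sum]
  refine Finset.sum_congr rfl fun e _ => Finset.sum_congr rfl fun w _ => ?_
  simp only [QEX, Pi.star_apply, star_mul']
  ring

theorem exampleState_star_dotProduct (c c' : Concept n) {D : Input n → ℝ}
    (hD : D ∈ stdSimplex ℝ (Input n)) :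
    star (exampleState c D) ⬝ᵥ exampleState c' D = ((1 - error D c c' : ℝ) : ℂ) := by
  have h1 : 1 - error D c c' = ∑ x, if c x = c' x then D x else 0 := by
    rw [← hD.2, error, Finset.sum_filter, ← Finset.sum_sub_distrib]
    refine Finset.sum_congr rfl fun x _ => ?_
    by_cases h : c x = c' x <;> simp [h]
  rw [h1, dotProduct, Fintype.sum_prod_type, Complex.ofReal_sum]
  refine Finset.sum_congr rfl fun x _ => ?_
  have h2 : (Real.sqrt (D x) : ℂ) * Real.sqrt (D x) = D x := by
    rw [← Complex.ofReal_mul, Real.mul_self_sqrt (hD.1 x)]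
  cases hc : c x <;> cases hc' : c' x <;> simp [exampleState, hc, hc', h2]

/-- The overlap of the states that the algorithm reaches for two target concepts. -/
theorem Algorithm.state_star_dotProduct (A : Algorithm n) (c c' : Concept n) {D : Input n → ℝ}
    (hD : D ∈ stdSimplex ℝ (Input n)) (hA : ∀ t < A.calls, LegalCall (A.state c D t)) :
    ∀ t ≤ A.calls,
      star (A.state c D t) ⬝ᵥ A.state c' D t = (((1 - error D c c') ^ t : ℝ) : ℂ)
  | 0, _ => by
    rw [Algorithm.state, Algorithm.state, unitary_star_dotProduct]
    simp
  | t + 1, ht => by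
    rw [Algorithm.state, Algorithm.state, unitary_star_dotProduct,
      QEX_star_dotProduct _ _ _ (hA t ht), exampleState_star_dotProduct _ _ hD,
      A.state_star_dotProduct c c' hD hA t (by omega), ← Complex.ofReal_mul, pow_succ']

theorem error_self (D : Input n → ℝ) (c : Concept n) : error D c c = 0 := by simp [error]

theorem Algorithm.sum_norm_sq_state (A : Algorithm n) (c : Concept n) {D : Input n → ℝ}
    (hD : D ∈ stdSimplex ℝ (Input n)) (hA : ∀ t < A.calls, LegalCall (A.state c D t)) :
    ∑ b, ‖A.state c D A.calls b‖ ^ 2 = 1 := by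
  have h := A.state_star_dotProduct c c hD hA A.calls le_rfl
  rw [error_self, sub_zero, one_pow, dotProduct] at h
  have h2 : ((∑ b, ‖A.state c D A.calls b‖ ^ 2 : ℝ) : ℂ) = ((1 : ℝ) : ℂ) := by
    rw [← h, Complex.ofReal_sum]
    refine Finset.sum_congr rfl fun b _ => ?_
    rw [Pi.star_apply, Complex.ofReal_pow]
    exact (Complex.conj_mul' _).symm
  exact_mod_cast h2

/-- Two unit vectors of large overlap cannot be told apart by a measurement. -/
theorem norm_sq_star_dotProduct_le {B : Type*} [Fintype B] {ψ φ : B → ℂ}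
    (hψ : ∑ b, ‖ψ b‖ ^ 2 = 1) (hφ : ∑ b, ‖φ b‖ ^ 2 = 1) (p : B → Prop) [DecidablePred p] :
    ‖star ψ ⬝ᵥ φ‖ ^ 2 ≤ 2 * (∑ b with ¬ p b, ‖ψ b‖ ^ 2 + ∑ b with p b, ‖φ b‖ ^ 2) := by
  have h0 : ‖star ψ ⬝ᵥ φ‖ ≤ ∑ b with p b, ‖ψ b‖ * ‖φ b‖ + ∑ b with ¬ p b, ‖ψ b‖ * ‖φ b‖ := by
    rw [Finset.sum_filter_add_sum_filter_not]
    refine (norm_sum_le _ _).trans (le_of_eq ?_)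
    exact Finset.sum_congr rfl fun b _ => by simp
  have hle (χ : B → ℂ) (hχ : ∑ b, ‖χ b‖ ^ 2 = 1) (s : Finset B) : ∑ b ∈ s, ‖χ b‖ ^ 2 ≤ 1 :=
    hχ ▸ Finset.sum_le_sum_of_subset_of_nonneg (Finset.subset_univ s) fun _ _ _ => sq_nonneg _
  have hcs (s : Finset B) := Finset.sum_mul_sq_le_sq_mul_sq s (fun b => ‖ψ b‖) (fun b => ‖φ b‖)
  have hn (χ : B → ℂ) (s : Finset B) : 0 ≤ ∑ b ∈ s, ‖χ b‖ ^ 2 :=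
    Finset.sum_nonneg fun _ _ => sq_nonneg _
  -- Cauchy–Schwarz on each half: where `p` holds the mass of `ψ` is bounded by 1, elsewhere that of
  -- `φ`. The halves combine by `(a + b)² ≤ 2 * (a² + b²)`.
  have h1 := (hcs (Finset.univ.filter p)).trans
    (mul_le_of_le_one_left (hn φ _) (hle ψ hψ _))
  have h2 := (hcs (Finset.univ.filter fun b => ¬ p b)).trans
    (mul_le_of_le_one_right (hn ψ _) (hle φ hφ _))
  have h3 := pow_le_pow_left₀ (norm_nonneg _) h0 2
  nlinarith [sq_nonneg (∑ b with p b, ‖ψ b‖ * ‖φ b‖ - ∑ b with ¬ p b, ‖ψ b‖ * ‖φ b‖)]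

/-- The probability that the hypothesis of the algorithm is wrong at `x`. -/
noncomputable def Algorithm.errorProbAt (A : Algorithm n) (c : Concept n) (D : Input n → ℝ)
    (x : Input n) : ℝ :=
  ∑ b with A.output b x ≠ c x, ‖A.state c D A.calls b‖ ^ 2

/-- Labels are Boolean, so a prediction at `x` that is right for `c` is wrong for `c'`: the output
bit at `x` is a test between the two final states. -/
theorem Algorithm.overlap_le_errorProbAt (A : Algorithm n) {c c' : Concept n} {D : Input n → ℝ}
    (hD : D ∈ stdSimplex ℝ (Input n)) (hc : ∀ t < A.calls, LegalCall (A.state c D t))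
    (hc' : ∀ t < A.calls, LegalCall (A.state c' D t)) {x : Input n} (hx : c x ≠ c' x) :
    (1 - error D c c') ^ (2 * A.calls) ≤ 2 * (A.errorProbAt c D x + A.errorProbAt c' D x) := by
  have h := norm_sq_star_dotProduct_le (A.sum_norm_sq_state c hD hc)
    (A.sum_norm_sq_state c' hD hc') (fun b => A.output b x = c x)
  rw [A.state_star_dotProduct c c' hD hc _ le_rfl, Complex.norm_real, Real.norm_eq_abs, sq_abs,
    ← pow_mul, mul_comm A.calls] at h
  have h2 : (Finset.univ.filter fun b => A.output b x ≠ c' x) =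
      Finset.univ.filter fun b => A.output b x = c x := by
    refine Finset.filter_congr fun b _ => ?_
    revert hx
    cases A.output b x <;> cases c x <;> cases c' x <;> simp
  rw [Algorithm.errorProbAt, Algorithm.errorProbAt, h2]
  exact h

/-! ### Consequences of PAC learning and hard distributions -/

open scoped Classical in
theorem Algorithm.sum_norm_sq_bad_le (A : Algorithm n) {C : Finset (Concept n)} {ε δ : ℝ}
    (hA : A.PACLearns C ε δ) {c : Concept n} (hc : c ∈ C) {D : Input n → ℝ}
    (hD : D ∈ stdSimplex ℝ (Input n)) :
    ∑ b with ¬ error D (A.output b) c ≤ ε, ‖A.state c D A.calls b‖ ^ 2 ≤ δ := by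
  obtain ⟨h1, h2⟩ := hA c hc D hD
  have h3 := A.sum_norm_sq_state c hD h1
  rw [← Finset.sum_filter_add_sum_filter_not _ fun b => error D (A.output b) c ≤ ε] at h3
  rw [Algorithm.successProb] at h2
  linarith

theorem le_error_of_ne {D : Input n → ℝ} (hD : D ∈ stdSimplex ℝ (Input n)) {h c : Concept n}
    {x : Input n} (hx : h x ≠ c x) : D x ≤ error D h c :=
  Finset.single_le_sum (fun y _ => hD.1 y) (by simpa using hx)

theorem Algorithm.errorProbAt_le (A : Algorithm n) {C : Finset (Concept n)} {ε δ : ℝ}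
    (hA : A.PACLearns C ε δ) {c : Concept n} (hc : c ∈ C) {D : Input n → ℝ}
    (hD : D ∈ stdSimplex ℝ (Input n)) {x : Input n} (hx : ε < D x) :
    A.errorProbAt c D x ≤ δ := by
  classical
  refine le_trans ?_ (A.sum_norm_sq_bad_le hA hc hD)
  refine Finset.sum_le_sum_of_subset_of_nonneg (fun b hb => ?_) fun _ _ _ => sq_nonneg _
  simp only [Finset.mem_filter, Finset.mem_univ, true_and] at hb ⊢
  exact not_le.2 (hx.trans_le (le_error_of_ne hD hb))

/-- Otherwise distinct concepts of `C` differ everywhere, hence are complementary. A concept has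
only one complement, so `C` would be trivial. -/
theorem exists_agree_differ {C : Finset (Concept n)} (hC : C.Nonempty) (hT : ¬ IsTrivialClass C) :
    ∃ c ∈ C, ∃ c' ∈ C, ∃ x y, c x = c' x ∧ c y ≠ c' y := by
  obtain ⟨c₀, h₀⟩ := hC
  by_contra! H
  have key : ∀ c ∈ C, ∀ c' ∈ C, c ≠ c' → ∀ x, c x ≠ c' x := fun c hc c' hc' hne x hx =>
    hne (funext (H c hc c' hc' x · hx))
  apply hT
  by_cases h : ∃ c₁ ∈ C, c₁ ≠ c₀
  · obtain ⟨c₁, h₁, hne⟩ := h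
    refine Or.inr ⟨c₀, c₁, ?_, key c₀ h₀ c₁ h₁ hne.symm⟩
    ext c
    simp only [Finset.mem_insert, Finset.mem_singleton]
    refine ⟨fun hc => ?_, by rintro (rfl | rfl) <;> assumption⟩
    by_contra! hcc
    obtain ⟨y, -⟩ := Function.ne_iff.1 hne
    have a := key c hc c₀ h₀ hcc.1 y
    have b := key c hc c₁ h₁ hcc.2 y
    have e := key c₁ h₁ c₀ h₀ hne y
    revert a b e
    cases c y <;> cases c₀ y <;> cases c₁ y <;> simp
  · push Not at h
    exact Or.inl ⟨c₀, Finset.eq_singleton_iff_unique_mem.2 ⟨h₀, h⟩⟩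

/-- The distribution with mass `p` spread uniformly over `W`, and the rest on the point `x₀`. -/
noncomputable def spikeDist (x₀ : Input n) (W : Finset (Input n)) (p : ℝ) : Input n → ℝ :=
  fun y => (if y = x₀ then 1 - p else 0) + if y ∈ W then p / W.card else 0

theorem spikeDist_mem_stdSimplex (x₀ : Input n) {W : Finset (Input n)} (hW : W.Nonempty) {p : ℝ}
    (hp : 0 ≤ p) (hp' : p ≤ 1) : spikeDist x₀ W p ∈ stdSimplex ℝ (Input n) := by
  constructor
  · intro y
    have : 0 ≤ p / W.card := by positivity
    unfold spikeDist
    split_ifs <;> linarith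
  · have : (W.card : ℝ) ≠ 0 := by exact_mod_cast hW.card_pos.ne'
    simp only [spikeDist, Finset.sum_add_distrib, Finset.sum_ite_eq', Finset.mem_univ, if_true,
      Finset.sum_ite_mem, Finset.univ_inter, Finset.sum_const, nsmul_eq_mul]
    field_simp
    ring

theorem spikeDist_apply_mem {x₀ y : Input n} {W : Finset (Input n)} (h₀ : x₀ ∉ W) (hy : y ∈ W)
    (p : ℝ) : spikeDist x₀ W p y = p / W.card := by
  have : y ≠ x₀ := fun h => h₀ (h ▸ hy)
  simp [spikeDist, this, hy]

theorem error_spikeDist {x₀ : Input n} {W : Finset (Input n)} (p : ℝ)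
    {h c : Concept n} (hc : h x₀ = c x₀) :
    error (spikeDist x₀ W p) h c = (W.filter fun y => h y ≠ c y).card * (p / W.card) := by
  have h1 : ∀ y, (if h y ≠ c y then spikeDist x₀ W p y else 0) =
      if y ∈ W.filter (fun y => h y ≠ c y) then p / W.card else 0 := by
    intro y
    by_cases hy : h y = c y
    · simp [hy]
    · have : y ≠ x₀ := by rintro rfl; exact hy hc
      simp [hy, spikeDist, this]
  rw [error, Finset.sum_filter, Finset.sum_congr rfl fun y _ => h1 y]
  rw [Finset.sum_ite_mem, Finset.univ_inter, Finset.sum_const, nsmul_eq_mul]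

/-- An output hypothesis may also err at `x₀`, which only increases the error. -/
theorem card_mul_le_error_spikeDist {x₀ : Input n} {W : Finset (Input n)} (h₀ : x₀ ∉ W) {p : ℝ}
    (hD : spikeDist x₀ W p ∈ stdSimplex ℝ (Input n)) (h c : Concept n) :
    (W.filter fun y => h y ≠ c y).card * (p / W.card) ≤ error (spikeDist x₀ W p) h c := by
  rw [← nsmul_eq_mul, ← Finset.sum_const, error]
  refine le_trans (le_of_eq (Finset.sum_congr rfl fun y hy => ?_))
    (Finset.sum_le_sum_of_subset_of_nonneg
      (Finset.filter_subset_filter _ (Finset.subset_univ W)) fun y _ _ => hD.1 y)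
  exact (spikeDist_apply_mem h₀ (Finset.mem_filter.1 hy).1 p).symm

/-- The sum is the expected number of wrong labels on `W`. A successful output has at most `W.card /
32` of them, since each costs `32 * ε / W.card`; a failure has at most `W.card`. -/
theorem Algorithm.sum_errorProbAt_le (A : Algorithm n) {C : Finset (Concept n)} {ε δ : ℝ}
    (hA : A.PACLearns C ε δ) (hε : 0 < ε) (hε' : 32 * ε ≤ 1) {c : Concept n} (hc : c ∈ C)
    {x₀ : Input n} {W : Finset (Input n)} (hW : W.Nonempty) (h₀ : x₀ ∉ W) :
    ∑ x ∈ W, A.errorProbAt c (spikeDist x₀ W (32 * ε)) x ≤ W.card * (1 / 32 + δ) := by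
  classical
  set D := spikeDist x₀ W (32 * ε)
  have hD : D ∈ stdSimplex ℝ (Input n) := spikeDist_mem_stdSimplex x₀ hW (by positivity) hε'
  have hk : (0 : ℝ) < W.card := by exact_mod_cast hW.card_pos
  have hsum : ∑ x ∈ W, A.errorProbAt c D x =
      ∑ b, (W.filter fun x => A.output b x ≠ c x).card * ‖A.state c D A.calls b‖ ^ 2 := by
    simp only [Algorithm.errorProbAt, Finset.sum_filter]
    rw [Finset.sum_comm]
    refine Finset.sum_congr rfl fun b _ => ?_
    rw [← Finset.sum_filter, Finset.sum_const, nsmul_eq_mul]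
  have hterm : ∀ b, ((W.filter fun x => A.output b x ≠ c x).card : ℝ) ≤
      W.card / 32 + if ¬ error D (A.output b) c ≤ ε then (W.card : ℝ) else 0 := by
    intro b
    split_ifs with hb
    · have h1 := (card_mul_le_error_spikeDist h₀ hD (A.output b) c).trans hb
      rw [add_zero, le_div_iff₀ (by norm_num)]
      rw [mul_div_assoc', div_le_iff₀ hk] at h1
      nlinarith
    · have : ((W.filter fun x => A.output b x ≠ c x).card : ℝ) ≤ W.card := by
        exact_mod_cast Finset.card_filter_le _ _
      linarith
  have hbad := A.sum_norm_sq_bad_le hA hc hD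
  calc ∑ x ∈ W, A.errorProbAt c D x
      ≤ ∑ b, (W.card / 32 + if ¬ error D (A.output b) c ≤ ε then (W.card : ℝ) else 0) *
          ‖A.state c D A.calls b‖ ^ 2 := by
        rw [hsum]
        exact Finset.sum_le_sum fun b _ => mul_le_mul_of_nonneg_right (hterm b) (sq_nonneg _)
    _ = W.card / 32 * ∑ b, ‖A.state c D A.calls b‖ ^ 2 +
          W.card * ∑ b with ¬ error D (A.output b) c ≤ ε, ‖A.state c D A.calls b‖ ^ 2 := by
        simp only [add_mul, Finset.sum_add_distrib, Finset.mul_sum, Finset.sum_filter, ite_mul,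
          zero_mul, mul_ite, mul_zero]
    _ ≤ W.card * (1 / 32 + δ) := by
        rw [A.sum_norm_sq_state c hD (hA c hc D hD).1]
        nlinarith

/-- Flipping the value of a concept at the point `x`. -/
def flipAt (x : Input n) (c : Concept n) : Concept n := Function.update c x (!c x)

theorem flipAt_involutive (x : Input n) : Function.Involutive (flipAt x) := by
  intro c
  simp [flipAt]

/-- A version of Assouad's lemma, for a class that realizes every labelling of `W` and labels `x₀`
by `0` at the same time. -/
theorem Algorithm.overlap_le_of_shatters (A : Algorithm n) {C : Finset (Concept n)} {ε δ : ℝ}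
    (hA : A.PACLearns C ε δ) (hε : 0 < ε) (hε' : 32 * ε ≤ 1)
    {x₀ : Input n} {W : Finset (Input n)} (hW : W.Nonempty) (h₀ : x₀ ∉ W)
    {f : Concept n → Concept n} (hfC : ∀ σ, f σ ∈ C) (hf₀ : ∀ σ, f σ x₀ = false)
    (hf : ∀ σ, ∀ x ∈ W, f σ x = σ x) :
    (1 - 32 * ε / W.card) ^ (2 * A.calls) ≤ 4 * (1 / 32 + δ) := by
  set D := spikeDist x₀ W (32 * ε) with hDdef
  have hD : D ∈ stdSimplex ℝ (Input n) := spikeDist_mem_stdSimplex x₀ hW (by positivity) hε'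
  have hk : (0 : ℝ) < W.card := by exact_mod_cast hW.card_pos
  set F := (1 - 32 * ε / W.card) ^ (2 * A.calls)
  have hpair : ∀ σ, ∀ x ∈ W,
      F ≤ 2 * (A.errorProbAt (f σ) D x + A.errorProbAt (f (flipAt x σ)) D x) := by
    intro σ x hx
    have hne : f σ x ≠ f (flipAt x σ) x := by simp [hf _ x hx, flipAt]
    -- Both concepts vanish at `x₀`, so the heavy point does not separate them; on `W` they differ
    -- only at `x`.
    have herr : error D (f σ) (f (flipAt x σ)) = 32 * ε / W.card := by
      have : (W.filter fun y => f σ y ≠ f (flipAt x σ) y) = {x} := by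
        ext y
        simp only [Finset.mem_filter, Finset.mem_singleton]
        refine ⟨fun ⟨hy, hy'⟩ => ?_, by rintro rfl; exact ⟨hx, hne⟩⟩
        by_contra hyx
        simp [hf _ y hy, flipAt, Function.update_of_ne hyx] at hy'
      rw [hDdef, error_spikeDist _ (by rw [hf₀, hf₀]), this]
      simp
    have := A.overlap_le_errorProbAt hD (hA _ (hfC σ) D hD).1
      (hA _ (hfC (flipAt x σ)) D hD).1 hne
    rwa [herr] at this
  have hN : (0 : ℝ) < Fintype.card (Concept n) := by exact_mod_cast Fintype.card_pos
  have hsum : Fintype.card (Concept n) * (W.card * F) ≤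
      4 * ∑ σ, ∑ x ∈ W, A.errorProbAt (f σ) D x := by
    calc Fintype.card (Concept n) * (W.card * F) = ∑ _σ : Concept n, ∑ _x ∈ W, F := by simp
      _ ≤ ∑ σ, ∑ x ∈ W, 2 * (A.errorProbAt (f σ) D x + A.errorProbAt (f (flipAt x σ)) D x) :=
        Finset.sum_le_sum fun σ _ => Finset.sum_le_sum fun x hx => hpair σ x hx
      _ = 2 * (∑ σ, ∑ x ∈ W, A.errorProbAt (f σ) D x +
            ∑ x ∈ W, ∑ σ, A.errorProbAt (f (flipAt x σ)) D x) := by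
        rw [Finset.sum_comm (s := W)]
        simp only [Finset.mul_sum, Finset.sum_add_distrib, mul_add]
      _ = 4 * ∑ σ, ∑ x ∈ W, A.errorProbAt (f σ) D x := by
        -- For fixed `x`, flipping permutes the labellings, so both sums are equal.
        rw [Finset.sum_congr rfl fun x _ => (flipAt_involutive x).bijective.sum_comp
          fun σ => A.errorProbAt (f σ) D x, Finset.sum_comm (s := W)]
        ring
  have hle : ∑ σ, ∑ x ∈ W, A.errorProbAt (f σ) D x ≤
      Fintype.card (Concept n) * (W.card * (1 / 32 + δ)) := by
    rw [← nsmul_eq_mul, ← Finset.card_univ, ← Finset.sum_const]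
    exact Finset.sum_le_sum fun σ _ => A.sum_errorProbAt_le hA hε hε' (hfC σ) hW h₀
  have hfin : Fintype.card (Concept n) * (W.card * F) ≤
      Fintype.card (Concept n) * (W.card * (4 * (1 / 32 + δ))) := by linarith
  exact le_of_mul_le_mul_left (le_of_mul_le_mul_left hfin hN) hk

/-- One point `x₀` of a largest shattered set is set aside to carry the heavy mass; traces omitting
`x₀` still realize every labelling of the rest. -/
theorem exists_shattered (C : Finset (Concept n)) (hC : 2 ≤ vcDimension C) :
    ∃ (x₀ : Input n) (W : Finset (Input n)), W.card + 1 = vcDimension C ∧ x₀ ∉ W ∧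
      ∃ f : Concept n → Concept n, (∀ σ, f σ ∈ C) ∧ (∀ σ, f σ x₀ = false) ∧
        ∀ σ, ∀ x ∈ W, f σ x = σ x := by
  have hne : (C.image Concept.toFinset).shatterer.Nonempty := by
    by_contra h
    rw [Finset.not_nonempty_iff_eq_empty] at h
    simp [vcDimension, Finset.vcDim, h] at hC
  obtain ⟨V, hV, hcard⟩ := Finset.exists_mem_eq_sup _ hne Finset.card
  rw [Finset.mem_shatterer] at hV
  change vcDimension C = V.card at hcard
  obtain ⟨x₀, hx₀⟩ : V.Nonempty := Finset.card_pos.1 (by omega)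
  have hex : ∀ σ : Concept n, ∃ c ∈ C, c x₀ = false ∧ ∀ x ∈ V.erase x₀, c x = σ x := by
    intro σ
    obtain ⟨u, hu, hVu⟩ := hV (t := (V.erase x₀).filter fun x => σ x = true)
      ((Finset.filter_subset _ _).trans (Finset.erase_subset _ _))
    obtain ⟨c, hc, rfl⟩ := Finset.mem_image.1 hu
    have key : ∀ x ∈ V, (c x = true ↔ x ≠ x₀ ∧ σ x = true) := by
      intro x hx
      have := Finset.ext_iff.1 hVu x
      simpa [Concept.toFinset, hx] using this
    refine ⟨c, hc, by simpa using key x₀ hx₀, fun x hx => ?_⟩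
    have := key x (Finset.mem_of_mem_erase hx)
    rw [Bool.eq_iff_iff, this]
    simp [Finset.ne_of_mem_erase hx]
  choose f hf using hex
  refine ⟨x₀, V.erase x₀, ?_, Finset.notMem_erase _ _, f, fun σ => (hf σ).1,
    fun σ => (hf σ).2.1, fun σ => (hf σ).2.2⟩
  rw [Finset.card_erase_add_one hx₀, hcard]

/-! ### Lower bounds on the number of calls -/

theorem Algorithm.log_le_calls (A : Algorithm n) {C : Finset (Concept n)} (hC : C.Nonempty)
    (hT : ¬ IsTrivialClass C) {ε δ : ℝ} (hε : 0 < ε) (hε' : ε < 1 / 32) (hδ : 0 < δ)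
    (hδ' : δ ≤ 1 / 5) (hA : A.PACLearns C ε δ) :
    1 / ε * Real.log (1 / δ) ≤ 80 * A.calls := by
  obtain ⟨c, hc, c', hc', x, y, hx, hy⟩ := exists_agree_differ hC hT
  have hxy : x ∉ ({y} : Finset (Input n)) := by
    rw [Finset.mem_singleton]
    rintro rfl
    exact hy hx
  -- Mass `2 * ε > ε` at `y` makes every hypothesis wrong at `y` a failure.
  have hD := spikeDist_mem_stdSimplex x (Finset.singleton_nonempty y) (p := 2 * ε)
    (by positivity) (by linarith)
  have hDy : ε < spikeDist x {y} (2 * ε) y := by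
    rw [spikeDist_apply_mem hxy (by simp)]
    simp [hε]
  have h := A.overlap_le_errorProbAt hD (hA c hc _ hD).1 (hA c' hc' _ hD).1 hy
  rw [error_spikeDist _ hx] at h
  have h1 := A.errorProbAt_le hA hc hD hDy
  have h2 := A.errorProbAt_le hA hc' hD hDy
  have h3 : (1 - 2 * ε) ^ (2 * A.calls) ≤ 4 * δ := by
    simp only [Finset.filter_singleton, ne_eq, hy, not_false_eq_true, if_true,
      Finset.card_singleton, Nat.cast_one, one_mul, div_one] at h
    linarith
  have hpos : 0 < 1 - 2 * ε := by linarith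
  have h4 := Real.log_le_log (by positivity) h3
  rw [Real.log_pow, Real.log_mul (by norm_num) hδ.ne'] at h4
  have h5 := Real.one_sub_inv_le_log_of_pos hpos
  have h6 : (1 - 2 * ε)⁻¹ ≤ 1 + 4 * ε := by
    rw [inv_le_iff_one_le_mul₀ hpos]
    nlinarith
  -- As `δ ≤ 1 / 5`, this absorbs the factor 4 of `h3`: `log 4` is at most nine tenths of `log (1 /
  -- δ)`. The remaining tenth is at most `8 * ε * A.calls`, whence 80.
  have h7 : 10 * Real.log 4 ≤ 9 * Real.log 5 := by
    have : Real.log ((4 : ℝ) ^ 10) ≤ Real.log ((5 : ℝ) ^ 9) :=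
      Real.log_le_log (by norm_num) (by norm_num)
    rw [Real.log_pow, Real.log_pow] at this
    exact_mod_cast this
  have h8 : Real.log δ ≤ - Real.log 5 := by
    rw [← Real.log_inv]
    exact Real.log_le_log hδ (by linarith)
  have h9 : (A.calls : ℝ) * (-(4 * ε)) ≤ A.calls * Real.log (1 - 2 * ε) :=
    mul_le_mul_of_nonneg_left (by linarith) (Nat.cast_nonneg _)
  rw [one_div δ, Real.log_inv, one_div_mul_eq_div, div_le_iff₀ hε]
  push_cast at h4
  linarith

theorem Algorithm.vcDimension_div_le_calls (A : Algorithm n) {C : Finset (Concept n)}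
    (hC : 2 ≤ vcDimension C) {ε δ : ℝ} (hε : 0 < ε) (hε' : ε < 1 / 32)
    (hδ' : δ ≤ 1 / 5) (hA : A.PACLearns C ε δ) :
    (vcDimension C : ℝ) / ε ≤ 2000 * A.calls := by
  obtain ⟨x₀, W, hcard, h₀, f, hfC, hf₀, hf⟩ := exists_shattered C hC
  have hW : W.Nonempty := Finset.card_pos.1 (by omega)
  have hk : (1 : ℝ) ≤ W.card := by exact_mod_cast hW.card_pos
  have h := A.overlap_le_of_shatters hA hε (by linarith) hW h₀ hfC hf₀ hf
  have hle : 32 * ε / W.card ≤ 1 := (div_le_one (by linarith)).2 (by linarith)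
  have hB := one_add_mul_le_pow (a := -(32 * ε / W.card)) (by linarith) (2 * A.calls)
  rw [← sub_eq_add_neg] at hB
  -- `3 / 40 = 1 - 4 * (1 / 32 + 1 / 5)`, the slack left in Bernoulli's inequality.
  have h1 : 3 / 40 ≤ 2 * A.calls * (32 * ε / W.card) := by
    push_cast at hB
    linarith
  rw [mul_div_assoc', le_div_iff₀ (by linarith)] at h1
  have hd : (vcDimension C : ℝ) = W.card + 1 := by exact_mod_cast hcard.symm
  rw [div_le_iff₀ hε, hd]
  nlinarith

end QPAC

theorem mainTheorem2 :
    ∃ κ : ℝ, 0 < κ ∧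
      ∀ (n d : ℕ) (C : Finset (QPAC.Concept n)),
        C.Nonempty → ¬ QPAC.IsTrivialClass C → QPAC.vcDimension C = d →
        ∀ ε δ : ℝ, 0 < ε → ε < 1 / 32 → 0 < δ → δ ≤ 1 / 5 →
        ∀ A : QPAC.Algorithm n, A.PACLearns C ε δ →
          κ * (1 / ε * Real.log (1 / δ) + (d : ℝ) + Real.sqrt (d : ℝ) / ε) ≤ (A.calls : ℝ) := by
  refine ⟨1 / 10000, by norm_num, fun n d C hC hT hd ε δ hε hε' hδ hδ' A hA => ?_⟩
  have hlog := A.log_le_calls hC hT hε hε' hδ hδ' hA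
  have hinv : 1 ≤ 1 / ε := (one_le_div hε).2 (by linarith)
  have hdim : (d : ℝ) / ε ≤ 2000 * A.calls := by
    rcases le_or_gt 2 d with h2 | h2
    · rw [← hd]
      exact A.vcDimension_div_le_calls (hd ▸ h2) hε hε' hδ' hA
    -- No spare point for `x₀` is available here, but `log (1 / δ) ≥ 1` lets the logarithmic bound
    -- cover `d / ε`.
    · have hd1 : (d : ℝ) ≤ 1 := by exact_mod_cast Nat.lt_succ_iff.1 h2
      have h5 : 1 ≤ Real.log (1 / δ) := by
        rw [Real.le_log_iff_exp_le (by positivity), le_div_iff₀ hδ]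
        nlinarith [Real.exp_one_lt_d9, Real.exp_pos 1]
      have h6 : (d : ℝ) / ε ≤ 1 / ε * Real.log (1 / δ) := by
        rw [div_eq_mul_one_div, mul_comm]
        exact mul_le_mul_of_nonneg_left (hd1.trans h5) (by linarith)
      have : (0 : ℝ) ≤ A.calls := Nat.cast_nonneg _
      linarith
  have hd0 : (0 : ℝ) ≤ d := Nat.cast_nonneg _
  have h1 : (d : ℝ) ≤ d / ε := by
    rw [div_eq_mul_one_div]
    exact le_mul_of_one_le_right hd0 hinv
  have h2 : Real.sqrt d / ε ≤ d / ε := by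
    refine div_le_div_of_nonneg_right ?_ hε.le
    rw [Real.sqrt_le_left hd0]
    exact_mod_cast Nat.le_self_pow two_ne_zero d
  have : (0 : ℝ) ≤ A.calls := Nat.cast_nonneg _
  linarith
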